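/- Let $d\ge 0$. Let $\mathcal P_2(\mathbb R^d)$ be the set of Borel probability measures on $\mathbb R^d$ with finite second moment, with the 2-Wasserstein distance $W_2(\mu,\nu)=\big(\inf_{\pi}\int \|x-y\|^2\,d\pi(x,y)\big)^{1/2}$, the infimum being over all couplings $\pi$ of $\mu$ and $\nu$. The Bures–Wasserstein space is the set of nondegenerate Gaussian measures $\mathcal N(m,\Sigma)$ ($m\in\mathbb R^d$, $\Sigma\in\mathbb R^{d\times d}$ symmetric positive definite) with the distance $W_2$, and $\mathrm{IG}=\{\mathcal N(m,\epsilon I_d): m\in\mathbb R^d,\ \epsilon>0\}$ is the set of isotropic Gaussian measures. In a metric space $(X,\rho)$, a geodesic from $x$ to $y$ is a curve $\gamma:[0,1]\to X$ with $\gamma(0)=x$, $\gamma(1)=y$ and $\rho(\gamma(s),\gamma(t))=|s-t|\,\rho(x,y)$ for all $s,t\in[0,1]$; a set $C\subseteq X$ is geodesically convex if any two points of $C$ are joined by a geodesic of $X$ and every geodesic of $X$ joining two points of $C$ is contained in $C$. Then: 1. $\mathrm{IG}$ is a geodesically convex subset of the Bures–Wasserstein space. 2. The Bures–Wasserstein space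 is geodesically convex in $(\mathcal P_2(\mathbb R^d),W_2)$. 3. For all $m_p,m_q\in\mathbb R^d$ and $\epsilon_p,\epsilon_q>0$ there is exactly one geodesic in $(\mathcal P_2(\mathbb R^d),W_2)$ from $\mathcal N(m_p,\epsilon_p I_d)$ to $\mathcal N(m_q,\epsilon_q I_d)$, namely $$t\mapsto \mathcal N\Big((1-t)m_p+t\,m_q,\ \big((1-t)+t\sqrt{\epsilon_q/\epsilon_p}\big)^2\epsilon_p\, I_d\Big),\qquad t\in[0,1].$$ -/

import Mathlib

open MeasureTheory ProbabilityTheory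
open scoped ENNReal

noncomputable section

/-- A (constant-speed, minimizing) geodesic from `x` to `y`, parametrized by `[0, 1]`, for the
distance `dist` on `X`. -/
def IsGeodesic {X : Type*} (dist : X → X → ℝ) (x y : X) (γ : unitInterval → X) : Prop :=
  γ 0 = x ∧ γ 1 = y ∧ ∀ s t : unitInterval, dist (γ s) (γ t) = |(s : ℝ) - (t : ℝ)| * dist x y

/-- `C` is geodesically convex in `(X, dist)`: any two points of `C` are joined by a geodesic
of `X`, and every geodesic of `X` between two points of `C` stays in `C`. -/
def GeodesicallyConvex {X : Type*} (dist : X → X → ℝ) (C : Set X) : Prop :=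
  ∀ x ∈ C, ∀ y ∈ C,
    (∃ γ : unitInterval → X, IsGeodesic dist x y γ) ∧
      ∀ γ : unitInterval → X, IsGeodesic dist x y γ → ∀ t, γ t ∈ C

/-- The set `𝒫₂(ℝᵈ)` of Borel probability measures on `ℝᵈ` with finite second moment. -/
def P2 (d : ℕ) : Type :=
  {μ : Measure (EuclideanSpace ℝ (Fin d)) // IsProbabilityMeasure μ ∧ MemLp id 2 μ}

/-- The couplings (transport plans) of two measures on `ℝᵈ`. -/
def couplings {d : ℕ} (μ ν : Measure (EuclideanSpace ℝ (Fin d))) :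
    Set (Measure (EuclideanSpace ℝ (Fin d) × EuclideanSpace ℝ (Fin d))) :=
  {π | π.fst = μ ∧ π.snd = ν}

/-- The quadratic transport cost `inf_π ∫ ‖x - y‖² dπ(x, y)` over all couplings `π`. It is finite
for measures in `𝒫₂(ℝᵈ)`. -/
def transportCost {d : ℕ} (μ ν : Measure (EuclideanSpace ℝ (Fin d))) : ℝ≥0∞ :=
  ⨅ π ∈ couplings μ ν, ∫⁻ z, edist z.1 z.2 ^ 2 ∂π

/-- The 2-Wasserstein distance on `𝒫₂(ℝᵈ)`. -/
def W2 {d : ℕ} (μ ν : P2 d) : ℝ :=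
  Real.sqrt (transportCost μ.1 ν.1).toReal

/-- The Gaussian measure `N(m, S)` as an element of `𝒫₂(ℝᵈ)`. -/
def gaussianP2 {d : ℕ} (m : EuclideanSpace ℝ (Fin d)) (S : Matrix (Fin d) (Fin d) ℝ) : P2 d :=
  ⟨multivariateGaussian m S, inferInstance, IsGaussian.memLp_two_id⟩

/-- The nondegenerate Gaussian measures on `ℝᵈ`. -/
def nondegenerateGaussians (d : ℕ) : Set (P2 d) :=
  {μ | ∃ (m : EuclideanSpace ℝ (Fin d)) (S : Matrix (Fin d) (Fin d) ℝ),
    S.PosDef ∧ μ = gaussianP2 m S}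

/-- The isotropic Gaussian measure `N(m, ε I)`. -/
def isotropicGaussian {d : ℕ} (m : EuclideanSpace ℝ (Fin d)) (ε : ℝ) : P2 d :=
  gaussianP2 m (ε • (1 : Matrix (Fin d) (Fin d) ℝ))

/-- The set `IG` of isotropic Gaussian measures on `ℝᵈ`. -/
def isotropicGaussians (d : ℕ) : Set (P2 d) :=
  {μ | ∃ (m : EuclideanSpace ℝ (Fin d)) (ε : ℝ), 0 < ε ∧ μ = isotropicGaussian m ε}

/-- The points of the Bures–Wasserstein space: the nondegenerate Gaussian measures. -/
abbrev BuresWasserstein (d : ℕ) : Type := nondegenerateGaussians d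

/-- The Bures–Wasserstein distance: the restriction of `W2` to nondegenerate Gaussians. -/
def BW {d : ℕ} (μ ν : BuresWasserstein d) : ℝ := W2 μ.1 ν.1

end

/-!
Gluing of couplings makes `W2` a metric on `P2 d`. If `M` is positive definite, the affine map
`T x = b + M x` is the gradient of a strongly convex quadratic, and the corresponding Kantorovich
potentials show more than its optimality: a plan that is almost optimal between `μ` and its image
under `T` is close in `L²` to the graph of `T`. Now let `ρ` lie at distances `s * W2 μ ν` and
`(1 - s) * W2 μ ν` from `μ` and `ν`, and glue two almost optimal plans into random vectors `X`,
`Z`, `Y` with laws `μ`, `ρ`, `ν`. Stewart's identity in `L²` then forces `Z` to be close to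
`(1 - s) X + s Y`, and stability forces `Y` to be close to `T X`, so that `ρ` is the law of
`(1 - s) X + s T X`. Hence displacement interpolation is the only geodesic from `μ` to `ν`.

The nondegenerate Gaussians `N(m, S)` and `N(n, S')` are related by such a map, with `M` the
positive definite solution of `M S M = S'`, and the interpolating maps `(1 - t) id + t T` are again
affine with positive definite linear part, so that they preserve Gaussians. In the isotropic case
all of these matrices are scalar.
-/

section Geodesics

variable {X : Type*} {dist : X → X → ℝ} {x y : X} {C D : Set X}

theorem isGeodesic_of_dist_le (comm : ∀ u v, dist u v = dist v u)
    (triangle : ∀ u v w, dist u w ≤ dist u v + dist v w) {γ : unitInterval → X}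
    (h0 : γ 0 = x) (h1 : γ 1 = y)
    (hle : ∀ s t : unitInterval, dist (γ s) (γ t) ≤ |(s : ℝ) - t| * dist x y) :
    IsGeodesic dist x y γ := by
  have key {s t : unitInterval} (hst : s ≤ t) :
      dist (γ s) (γ t) = |(s : ℝ) - t| * dist x y := by
    refine (hle s t).antisymm ?_
    have start := hle 0 s
    have finish := hle t 1
    have middle : |(s : ℝ) - t| = t - s := by
      rw [abs_sub_comm, abs_of_nonneg (sub_nonneg.2 (Subtype.coe_le_coe.2 hst))]
    rw [h0, Set.Icc.coe_zero, zero_sub, abs_neg, abs_of_nonneg s.2.1] at start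
    rw [h1, Set.Icc.coe_one, abs_sub_comm, abs_of_nonneg (sub_nonneg.2 t.2.2)] at finish
    rw [middle]
    linarith [triangle x (γ s) y, triangle (γ s) (γ t) y]
  refine ⟨h0, h1, fun s t ↦ ?_⟩
  rcases le_total s t with hst | hts
  · exact key hst
  · rw [comm, abs_sub_comm, key hts]

theorem GeodesicallyConvex.of_unique (h : ∀ x ∈ C, ∀ y ∈ C, ∃ γ₀ : unitInterval → X,
    (∀ t, γ₀ t ∈ C) ∧ ∀ γ, IsGeodesic dist x y γ ↔ ∀ t, γ t = γ₀ t) :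
    GeodesicallyConvex dist C := by
  intro x hx y hy
  obtain ⟨γ₀, hγ₀, hiff⟩ := h x hx y hy
  exact ⟨⟨γ₀, (hiff γ₀).2 fun _ ↦ rfl⟩, fun γ hγ t ↦ (hiff γ).1 hγ t ▸ hγ₀ t⟩

theorem GeodesicallyConvex.subtype (hC : GeodesicallyConvex dist C) (hCD : C ⊆ D) :
    GeodesicallyConvex (fun u v : D ↦ dist u v) {u : D | (u : X) ∈ C} := by
  rintro x hx y hy
  obtain ⟨⟨γ, hγ⟩, hmem⟩ := hC x hx y hy
  refine ⟨⟨fun t ↦ ⟨γ t, hCD (hmem γ hγ t)⟩, ?_⟩, fun γ hγ ↦ ?_⟩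
  · exact ⟨Subtype.ext hγ.1, Subtype.ext hγ.2.1, hγ.2.2⟩
  · exact hmem (fun t ↦ γ t)
      ⟨congrArg Subtype.val hγ.1, congrArg Subtype.val hγ.2.1, hγ.2.2⟩

end Geodesics

section Gluing

open ProbabilityTheory.Kernel in
theorem exists_gluing {X Y Z : Type*} [MeasurableSpace X] [MeasurableSpace Y]
    [MeasurableSpace Z] [StandardBorelSpace Z] [Nonempty Z] (π : Measure (X × Y))
    (π' : Measure (Y × Z)) [SFinite π] [IsFiniteMeasure π'] (h : π.snd = π'.fst) :
    ∃ η : Measure ((X × Y) × Z),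
      HasLaw Prod.fst π η ∧ HasLaw (fun w ↦ (w.1.2, w.2)) π' η := by
  refine ⟨π ⊗ₘ π'.condKernel.comap Prod.snd measurable_snd, ⟨by fun_prop, ?_⟩,
    ⟨by fun_prop, ?_⟩⟩
  · exact Measure.fst_compProd _ _
  · ext s hs
    conv_rhs => rw [← π'.disintegrate π'.condKernel, Measure.compProd_apply hs, ← h, Measure.snd,
      lintegral_map (measurable_kernel_prodMk_left hs) measurable_snd]
    rw [Measure.map_apply (by fun_prop) hs, Measure.compProd_apply (hs.preimage (by fun_prop))]
    rfl

end Gluing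

section LpNorm

variable {Ω Ω' E : Type*} {mΩ : MeasurableSpace Ω} {mΩ' : MeasurableSpace Ω'} {P : Measure Ω}
  {P' : Measure Ω'} {W : Ω → Ω'}

theorem lpNorm_comp_hasLaw [NormedAddCommGroup E] {f : Ω' → E} {p : ℝ≥0∞}
    (hf : AEStronglyMeasurable f P') (hW : HasLaw W P' P) :
    lpNorm (f ∘ W) p P = lpNorm f p P' := by
  obtain ⟨hW, rfl⟩ := hW
  rw [← toReal_eLpNorm hf, ← toReal_eLpNorm (hf.comp_aemeasurable hW),
    eLpNorm_map_measure hf hW]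

theorem memLp_comp_hasLaw [NormedAddCommGroup E] {f : Ω' → E} {p : ℝ≥0∞}
    (hf : MemLp f p P') (hW : HasLaw W P' P) : MemLp (f ∘ W) p P := by
  obtain ⟨hW, rfl⟩ := hW
  exact hf.comp_of_map hW

theorem integrable_comp_hasLaw [NormedAddCommGroup E] {f : Ω' → E}
    (hf : Integrable f P') (hW : HasLaw W P' P) : Integrable (f ∘ W) P :=
  memLp_one_iff_integrable.1 (memLp_comp_hasLaw (memLp_one_iff_integrable.2 hf) hW)

theorem sq_lpNorm_two [NormedAddCommGroup E] {f : Ω → E} (hf : AEStronglyMeasurable f P) :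
    lpNorm f 2 P ^ 2 = ∫ ω, ‖f ω‖ ^ 2 ∂P := by
  rw [lpNorm_eq_integral_norm_rpow_toReal two_ne_zero ENNReal.ofNat_ne_top hf,
    ENNReal.toReal_ofNat, ← Real.rpow_mul_natCast (by positivity)]
  norm_num

theorem integral_norm_le_lpNorm_two [NormedAddCommGroup E] [IsProbabilityMeasure P] {f : Ω → E}
    (hf : MemLp f 2 P) : ∫ ω, ‖f ω‖ ∂P ≤ lpNorm f 2 P := by
  rw [← lpNorm_one_eq_integral_norm hf.1, ← toReal_eLpNorm hf.1, ← toReal_eLpNorm hf.1]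
  exact ENNReal.toReal_mono hf.eLpNorm_ne_top
    (eLpNorm_le_eLpNorm_of_exponent_le one_le_two hf.1)

variable [NormedAddCommGroup E] [InnerProductSpace ℝ E]

theorem stewart_identity (x y z : E) (s : ℝ) :
    s * (1 - s) * ‖x - y‖ ^ 2 + ‖z - ((1 - s) • x + s • y)‖ ^ 2 =
      (1 - s) * ‖x - z‖ ^ 2 + s * ‖z - y‖ ^ 2 := by
  simp only [← real_inner_self_eq_norm_sq, inner_sub_left, inner_sub_right, inner_add_left,
    inner_add_right, real_inner_smul_left, real_inner_smul_right, real_inner_comm x y,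
    real_inner_comm x z, real_inner_comm y z]
  ring

theorem lpNorm_stewart_identity {X Y Z : Ω → E} (hX : MemLp X 2 P) (hY : MemLp Y 2 P)
    (hZ : MemLp Z 2 P) (s : ℝ) :
    s * (1 - s) * lpNorm (X - Y) 2 P ^ 2 + lpNorm (Z - ((1 - s) • X + s • Y)) 2 P ^ 2 =
      (1 - s) * lpNorm (X - Z) 2 P ^ 2 + s * lpNorm (Z - Y) 2 P ^ 2 := by
  have hXY := hX.sub hY
  have hXZ := hX.sub hZ
  have hZY := hZ.sub hY
  have hZXY := hZ.sub ((hX.const_smul (1 - s)).add (hY.const_smul s))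
  simp only [sq_lpNorm_two hXY.1, sq_lpNorm_two hXZ.1, sq_lpNorm_two hZY.1, sq_lpNorm_two hZXY.1,
    ← integral_const_mul]
  rw [← integral_add (hXY.norm.integrable_sq.const_mul _) hZXY.norm.integrable_sq,
    ← integral_add (hXZ.norm.integrable_sq.const_mul _) (hZY.norm.integrable_sq.const_mul _)]
  exact integral_congr_ae (.of_forall fun ω ↦ stewart_identity (X ω) (Y ω) (Z ω) s)

end LpNorm

section CharFun

variable {Ω E : Type*} {mΩ : MeasurableSpace Ω} {P : Measure Ω} [NormedAddCommGroup E]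
  [InnerProductSpace ℝ E]

theorem norm_exp_inner_mul_I_sub_le (x y ξ : E) :
    ‖Complex.exp (inner ℝ x ξ * Complex.I) - Complex.exp (inner ℝ y ξ * Complex.I)‖ ≤
      ‖ξ‖ * ‖x - y‖ := by
  have factor : Complex.exp (inner ℝ x ξ * Complex.I) - Complex.exp (inner ℝ y ξ * Complex.I) =
      Complex.exp (inner ℝ y ξ * Complex.I) *
        (Complex.exp (Complex.I * (inner ℝ (x - y) ξ : ℝ)) - 1) := by
    rw [mul_sub, ← Complex.exp_add, inner_sub_left]
    push_cast
    ring_nf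
  rw [factor, norm_mul, Complex.norm_exp_ofReal_mul_I, one_mul, mul_comm ‖ξ‖]
  exact Real.norm_exp_I_mul_ofReal_sub_one_le.trans (norm_inner_le_norm _ _)

variable [MeasurableSpace E] [BorelSpace E] [SecondCountableTopology E] {μ ν : Measure E}
  {X Y : Ω → E}

theorem norm_charFun_sub_le_integral_norm_sub [IsFiniteMeasure P] (hX : HasLaw X μ P)
    (hY : HasLaw Y ν P) (hXY : Integrable (X - Y) P) (ξ : E) :
    ‖charFun μ ξ - charFun ν ξ‖ ≤ ‖ξ‖ * ∫ ω, ‖(X - Y) ω‖ ∂P := by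
  have charFun_eq {σ : Measure E} {Z : Ω → E} (hZ : HasLaw Z σ P) :
      charFun σ ξ = ∫ ω, Complex.exp (inner ℝ (Z ω) ξ * Complex.I) ∂P :=
    (hZ.integral_comp (f := fun x ↦ Complex.exp (inner ℝ x ξ * Complex.I)) (by fun_prop)).symm
  have integrable {Z : Ω → E} (hZ : AEMeasurable Z P) :
      Integrable (fun ω ↦ Complex.exp (inner ℝ (Z ω) ξ * Complex.I)) P :=
    .of_bound (AEMeasurable.aestronglyMeasurable (by fun_prop)) 1
      (.of_forall fun ω ↦ (Complex.norm_exp_ofReal_mul_I _).le)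
  rw [charFun_eq hX, charFun_eq hY,
    ← integral_sub (integrable hX.aemeasurable) (integrable hY.aemeasurable),
    ← integral_const_mul]
  exact norm_integral_le_of_norm_le (hXY.norm.const_mul ‖ξ‖)
    (.of_forall fun ω ↦ norm_exp_inner_mul_I_sub_le (X ω) (Y ω) ξ)

end CharFun

section Wasserstein

variable {d : ℕ} {μ ν ρ : P2 d} {Ω : Type*} {mΩ : MeasurableSpace Ω} {P : Measure Ω}
  {X Y : Ω → EuclideanSpace ℝ (Fin d)}
  {π : Measure (EuclideanSpace ℝ (Fin d) × EuclideanSpace ℝ (Fin d))}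

instance P2.isProbabilityMeasure (μ : P2 d) : IsProbabilityMeasure μ.1 := μ.2.1

theorem P2.memLp_of_hasLaw (hX : HasLaw X μ.1 P) : MemLp X 2 P :=
  memLp_comp_hasLaw (f := id) μ.2.2 hX

theorem couplings.hasLaw_fst {μ ν : Measure (EuclideanSpace ℝ (Fin d))}
    (hπ : π ∈ couplings μ ν) : HasLaw Prod.fst μ π :=
  ⟨by fun_prop, hπ.1⟩

theorem couplings.hasLaw_snd {μ ν : Measure (EuclideanSpace ℝ (Fin d))}
    (hπ : π ∈ couplings μ ν) : HasLaw Prod.snd ν π :=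
  ⟨by fun_prop, hπ.2⟩

theorem couplings.memLp_fst_sub_snd (hπ : π ∈ couplings μ.1 ν.1) :
    MemLp (Prod.fst - Prod.snd) 2 π :=
  (P2.memLp_of_hasLaw (couplings.hasLaw_fst hπ)).sub
    (P2.memLp_of_hasLaw (couplings.hasLaw_snd hπ))

theorem couplings.map_prodMk_mem {μ ν : Measure (EuclideanSpace ℝ (Fin d))}
    (hX : HasLaw X μ P) (hY : HasLaw Y ν P) :
    P.map (fun ω ↦ (X ω, Y ω)) ∈ couplings μ ν :=
  ⟨by rw [Measure.fst_map_prodMk₀ hY.aemeasurable, hX.map_eq],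
    by rw [Measure.snd_map_prodMk₀ hX.aemeasurable, hY.map_eq]⟩

theorem lintegral_edist_sq_eq_eLpNorm_sub_sq :
    ∫⁻ ω, edist (X ω) (Y ω) ^ 2 ∂P = eLpNorm (X - Y) 2 P ^ 2 := by
  have := eLpNorm_nnreal_pow_eq_lintegral (μ := P) (f := X - Y) (p := 2) two_ne_zero
  simpa [edist_eq_enorm_sub] using this.symm

theorem W2_le_lpNorm_sub (hX : HasLaw X μ.1 P) (hY : HasLaw Y ν.1 P) :
    W2 μ ν ≤ lpNorm (X - Y) 2 P := by
  have hXY := (P2.memLp_of_hasLaw hX).sub (P2.memLp_of_hasLaw hY)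
  have hcost : transportCost μ.1 ν.1 ≤ eLpNorm (X - Y) 2 P ^ 2 := by
    refine (iInf₂_le _ (couplings.map_prodMk_mem hX hY)).trans_eq ?_
    rw [lintegral_map' (by fun_prop) (by fun_prop), lintegral_edist_sq_eq_eLpNorm_sub_sq]
  rw [W2, Real.sqrt_le_left lpNorm_nonneg, ← toReal_eLpNorm hXY.1, ← ENNReal.toReal_pow]
  exact ENNReal.toReal_mono (ENNReal.pow_ne_top hXY.eLpNorm_ne_top) hcost

theorem transportCost_ne_top : transportCost μ.1 ν.1 ≠ ∞ := by
  have hπ : μ.1.prod ν.1 ∈ couplings μ.1 ν.1 := ⟨by simp, by simp⟩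
  refine ne_top_of_le_ne_top ?_ (iInf₂_le _ hπ)
  rw [lintegral_edist_sq_eq_eLpNorm_sub_sq]
  exact ENNReal.pow_ne_top (couplings.memLp_fst_sub_snd hπ).eLpNorm_ne_top

theorem exists_mem_couplings_lpNorm_lt {r : ℝ} (h : W2 μ ν < r) :
    ∃ π ∈ couplings μ.1 ν.1, lpNorm (Prod.fst - Prod.snd) 2 π < r := by
  have hr : 0 < r := (Real.sqrt_nonneg _).trans_lt h
  have hcost : transportCost μ.1 ν.1 < ENNReal.ofReal r ^ 2 := by
    rwa [← ENNReal.ofReal_pow hr.le, ENNReal.lt_ofReal_iff_toReal_lt transportCost_ne_top,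
      ← Real.sqrt_lt' hr]
  obtain ⟨π, hπ, hlt⟩ : ∃ π, ∃ _ : π ∈ couplings μ.1 ν.1,
      ∫⁻ z, edist z.1 z.2 ^ 2 ∂π < ENNReal.ofReal r ^ 2 := by
    simpa only [transportCost, iInf_lt_iff] using hcost
  refine ⟨π, hπ, (ENNReal.ofReal_lt_ofReal_iff hr).1
    ((ENNReal.pow_lt_pow_left_iff two_ne_zero).1 ?_)⟩
  rwa [ofReal_lpNorm (couplings.memLp_fst_sub_snd hπ), ← lintegral_edist_sq_eq_eLpNorm_sub_sq]

theorem W2_nonneg (μ ν : P2 d) : 0 ≤ W2 μ ν := Real.sqrt_nonneg _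

theorem W2_comm (μ ν : P2 d) : W2 μ ν = W2 ν μ := by
  have le (μ ν : P2 d) : W2 ν μ ≤ W2 μ ν := by
    refine le_of_forall_gt_imp_ge_of_dense fun r hr ↦ ?_
    obtain ⟨π, hπ, hlt⟩ := exists_mem_couplings_lpNorm_lt hr
    rw [lpNorm_sub_comm] at hlt
    exact (W2_le_lpNorm_sub (couplings.hasLaw_snd hπ) (couplings.hasLaw_fst hπ)).trans hlt.le
  exact (le ν μ).antisymm (le μ ν)

theorem exists_hasLaw_lpNorm_sub_lt {r r' : ℝ} (h : W2 μ ρ < r) (h' : W2 ρ ν < r') :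
    ∃ (P : Measure ((EuclideanSpace ℝ (Fin d) × EuclideanSpace ℝ (Fin d)) ×
        EuclideanSpace ℝ (Fin d))) (X Z Y : _ → EuclideanSpace ℝ (Fin d)),
      HasLaw X μ.1 P ∧ HasLaw Z ρ.1 P ∧ HasLaw Y ν.1 P ∧
        lpNorm (X - Z) 2 P < r ∧ lpNorm (Z - Y) 2 P < r' := by
  obtain ⟨π, hπ, hlt⟩ := exists_mem_couplings_lpNorm_lt h
  obtain ⟨π', hπ', hlt'⟩ := exists_mem_couplings_lpNorm_lt h'
  have := (couplings.hasLaw_fst hπ).isProbabilityMeasure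
  have := (couplings.hasLaw_fst hπ').isProbabilityMeasure
  obtain ⟨P, hP, hP'⟩ := exists_gluing π π' (hπ.2.trans hπ'.1.symm)
  refine ⟨P, fun w ↦ w.1.1, fun w ↦ w.1.2, fun w ↦ w.2, (couplings.hasLaw_fst hπ).comp hP,
    (couplings.hasLaw_snd hπ).comp hP, (couplings.hasLaw_snd hπ').comp hP', ?_, ?_⟩
  · rwa [← lpNorm_comp_hasLaw (by fun_prop) hP] at hlt
  · rwa [← lpNorm_comp_hasLaw (by fun_prop) hP'] at hlt'

theorem W2_triangle (μ ρ ν : P2 d) : W2 μ ν ≤ W2 μ ρ + W2 ρ ν := by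
  refine le_of_forall_gt_imp_ge_of_dense fun r hr ↦ ?_
  obtain ⟨P, X, Z, Y, hX, hZ, hY, hXZ, hZY⟩ := exists_hasLaw_lpNorm_sub_lt (μ := μ) (ρ := ρ)
    (ν := ν) (r := W2 μ ρ + (r - (W2 μ ρ + W2 ρ ν)) / 2)
    (r' := W2 ρ ν + (r - (W2 μ ρ + W2 ρ ν)) / 2) (by linarith) (by linarith)
  calc W2 μ ν ≤ lpNorm (X - Y) 2 P := W2_le_lpNorm_sub hX hY
    _ ≤ lpNorm (X - Z) 2 P + lpNorm (Z - Y) 2 P :=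
      lpNorm_sub_le_lpNorm_sub_add_lpNorm_sub (P2.memLp_of_hasLaw hX) (P2.memLp_of_hasLaw hZ)
        one_le_two
    _ ≤ r := by linarith

theorem norm_charFun_sub_le_W2 (μ ν : P2 d) (ξ : EuclideanSpace ℝ (Fin d)) :
    ‖charFun μ.1 ξ - charFun ν.1 ξ‖ ≤ ‖ξ‖ * W2 μ ν := by
  have bound (r : ℝ) (hr : W2 μ ν < r) : ‖charFun μ.1 ξ - charFun ν.1 ξ‖ ≤ ‖ξ‖ * r := by
    obtain ⟨π, hπ, hlt⟩ := exists_mem_couplings_lpNorm_lt hr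
    have hmem := couplings.memLp_fst_sub_snd hπ
    have := (couplings.hasLaw_fst hπ).isProbabilityMeasure
    refine (norm_charFun_sub_le_integral_norm_sub (couplings.hasLaw_fst hπ)
      (couplings.hasLaw_snd hπ) (hmem.integrable one_le_two) ξ).trans ?_
    gcongr
    exact (integral_norm_le_lpNorm_two hmem).trans hlt.le
  exact ge_of_tendsto
    ((continuous_const_mul ‖ξ‖).continuousWithinAt (s := Set.Ioi (W2 μ ν)) (x := W2 μ ν))
    (Filter.eventually_of_mem self_mem_nhdsWithin bound)

theorem eq_of_W2_eq_zero (h : W2 μ ν = 0) : μ = ν := by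
  refine Subtype.ext (Measure.ext_of_charFun (funext fun ξ ↦ ?_))
  have := norm_charFun_sub_le_W2 μ ν ξ
  rwa [h, mul_zero, norm_le_zero_iff, sub_eq_zero] at this

end Wasserstein

section StableTransport

variable {d : ℕ}

/-- The map `T` transports `μ` to `ν` optimally, and stably with modulus `a`: the excess cost of
a plan controls its squared `L²` distance to the graph of `T`. -/
structure IsStableTransport (T : EuclideanSpace ℝ (Fin d) → EuclideanSpace ℝ (Fin d)) (a : ℝ)
    (μ ν : P2 d) : Prop where
  pos : 0 < a
  hasLaw : HasLaw T ν.1 μ.1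
  sq_lpNorm_add_le : ∀ π ∈ couplings μ.1 ν.1,
    lpNorm (id - T) 2 μ.1 ^ 2 + a * lpNorm (Prod.snd - T ∘ Prod.fst) 2 π ^ 2 ≤
      lpNorm (Prod.fst - Prod.snd) 2 π ^ 2

namespace IsStableTransport

variable {T : EuclideanSpace ℝ (Fin d) → EuclideanSpace ℝ (Fin d)} {a : ℝ} {μ ν ρ σ : P2 d}
  {s t : ℝ} {Ω : Type*} {mΩ : MeasurableSpace Ω} {P : Measure Ω}
  {X Y Z : Ω → EuclideanSpace ℝ (Fin d)}

theorem W2_eq (h : IsStableTransport T a μ ν) : W2 μ ν = lpNorm (id - T) 2 μ.1 := by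
  refine (W2_le_lpNorm_sub .id h.hasLaw).antisymm
    (le_of_forall_gt_imp_ge_of_dense fun r hr ↦ ?_)
  obtain ⟨π, hπ, hlt⟩ := exists_mem_couplings_lpNorm_lt hr
  have hexcess : 0 ≤ a * lpNorm (Prod.snd - T ∘ Prod.fst) 2 π ^ 2 :=
    mul_nonneg h.pos.le (sq_nonneg _)
  have hcost := h.sq_lpNorm_add_le π hπ
  exact (le_of_sq_le_sq (by linarith) lpNorm_nonneg).trans hlt.le

theorem sq_W2_add_le (h : IsStableTransport T a μ ν) (hX : HasLaw X μ.1 P)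
    (hY : HasLaw Y ν.1 P) :
    W2 μ ν ^ 2 + a * lpNorm (Y - T ∘ X) 2 P ^ 2 ≤ lpNorm (X - Y) 2 P ^ 2 := by
  set W : Ω → EuclideanSpace ℝ (Fin d) × EuclideanSpace ℝ (Fin d) := fun ω ↦ (X ω, Y ω)
  have hπ : P.map W ∈ couplings μ.1 ν.1 := couplings.map_prodMk_mem hX hY
  have hW : HasLaw W (P.map W) P := ⟨by fun_prop, rfl⟩
  have hT : AEStronglyMeasurable (Prod.snd - T ∘ Prod.fst) (P.map W) :=
    (couplings.hasLaw_snd hπ).aemeasurable.aestronglyMeasurable.sub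
      (h.hasLaw.comp (couplings.hasLaw_fst hπ)).aemeasurable.aestronglyMeasurable
  have hcost := h.sq_lpNorm_add_le _ hπ
  rwa [← h.W2_eq, ← lpNorm_comp_hasLaw hT hW, ← lpNorm_comp_hasLaw (by fun_prop) hW] at hcost

theorem W2_displacement_le (h : IsStableTransport T a μ ν)
    (hρ : HasLaw ((1 - s) • id + s • T) ρ.1 μ.1) (hσ : HasLaw ((1 - t) • id + t • T) σ.1 μ.1) :
    W2 ρ σ ≤ |s - t| * W2 μ ν := by
  refine (W2_le_lpNorm_sub hρ hσ).trans_eq ?_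
  have hsub : (1 - s) • id + s • T - ((1 - t) • id + t • T) = (t - s) • (id - T) := by
    ext1 x
    simp only [Pi.sub_apply, Pi.add_apply, Pi.smul_apply]
    module
  rw [hsub, lpNorm_const_smul, h.W2_eq, coe_nnnorm, Real.norm_eq_abs, abs_sub_comm]

theorem sq_lpNorm_sub_displacement_le (h : IsStableTransport T a μ ν) (hX : HasLaw X μ.1 P)
    (hY : HasLaw Y ν.1 P) (hZ : MemLp Z 2 P) (hs0 : 0 ≤ s) (hs1 : s < 1) :
    lpNorm (Z - ((1 - s) • id + s • T) ∘ X) 2 P ^ 2 ≤ 2 * (1 + s / ((1 - s) * a)) *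
      ((1 - s) * lpNorm (X - Z) 2 P ^ 2 + s * lpNorm (Z - Y) 2 P ^ 2 -
        s * (1 - s) * W2 μ ν ^ 2) := by
  have hX' := P2.memLp_of_hasLaw hX
  have hY' := P2.memLp_of_hasLaw hY
  set e := lpNorm (Z - ((1 - s) • X + s • Y)) 2 P
  set f := lpNorm (Y - T ∘ X) 2 P
  have htriangle : lpNorm (Z - ((1 - s) • id + s • T) ∘ X) 2 P ≤ e + s * f := by
    have hsplit : Z - ((1 - s) • id + s • T) ∘ X =
        Z - ((1 - s) • X + s • Y) + s • (Y - T ∘ X) := by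
      ext1 ω
      simp only [Pi.sub_apply, Pi.add_apply, Pi.smul_apply, Function.comp_apply, id]
      module
    rw [hsplit]
    refine (lpNorm_add_le (hZ.sub ((hX'.const_smul _).add (hY'.const_smul _)))
      one_le_two).trans_eq ?_
    rw [lpNorm_const_smul, coe_nnnorm, Real.norm_of_nonneg hs0]
  have hstewart := lpNorm_stewart_identity hX' hY' hZ s
  have hstable := mul_le_mul_of_nonneg_left (h.sq_W2_add_le hX hY)
    (mul_nonneg hs0 (sub_nonneg.2 hs1.le))
  set D := (1 - s) * lpNorm (X - Z) 2 P ^ 2 + s * lpNorm (Z - Y) 2 P ^ 2 -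
    s * (1 - s) * W2 μ ν ^ 2
  have ha := h.pos
  have hs1' : 0 < 1 - s := sub_pos.2 hs1
  have hf : 0 ≤ s * (1 - s) * a * f ^ 2 := by positivity
  have he2 : e ^ 2 ≤ D := by linarith
  have hf2 : s * (1 - s) * a * f ^ 2 ≤ D := by linarith [sq_nonneg e]
  calc lpNorm (Z - ((1 - s) • id + s • T) ∘ X) 2 P ^ 2 ≤ (e + s * f) ^ 2 :=
        pow_le_pow_left₀ lpNorm_nonneg htriangle 2
    _ ≤ 2 * (e ^ 2 + (s * f) ^ 2) := add_sq_le
    _ = 2 * (e ^ 2 + s / ((1 - s) * a) * (s * (1 - s) * a * f ^ 2)) := by field_simp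
    _ ≤ 2 * (D + s / ((1 - s) * a) * D) := by gcongr
    _ = 2 * (1 + s / ((1 - s) * a)) * D := by ring

theorem eq_of_W2_le (h : IsStableTransport T a μ ν) (hs0 : 0 ≤ s) (hs1 : s ≤ 1)
    (hμρ : W2 μ ρ ≤ s * W2 μ ν) (hρν : W2 ρ ν ≤ (1 - s) * W2 μ ν)
    (hσ : HasLaw ((1 - s) • id + s • T) σ.1 μ.1) : ρ = σ := by
  rcases hs1.eq_or_lt with rfl | hs1
  · have hσν : σ = ν := Subtype.ext (hσ.map_eq.symm.trans (by simpa using h.hasLaw.map_eq))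
    rw [hσν]
    exact eq_of_W2_eq_zero ((W2_nonneg ρ ν).antisymm' (by simpa using hρν))
  set W := W2 μ ν
  let bound : ℝ → ℝ := fun δ ↦ 2 * (1 + s / ((1 - s) * a)) *
    ((1 - s) * (s * W + δ) ^ 2 + s * ((1 - s) * W + δ) ^ 2 - s * (1 - s) * W ^ 2)
  have hbound (δ : ℝ) (hδ : 0 < δ) : W2 ρ σ ^ 2 ≤ bound δ := by
    obtain ⟨P, X, Z, Y, hX, hZ, hY, hXZ, hZY⟩ := exists_hasLaw_lpNorm_sub_lt
      (hμρ.trans_lt (lt_add_of_pos_right _ hδ)) (hρν.trans_lt (lt_add_of_pos_right _ hδ))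
    calc W2 ρ σ ^ 2 ≤ lpNorm (Z - ((1 - s) • id + s • T) ∘ X) 2 P ^ 2 :=
          pow_le_pow_left₀ (W2_nonneg _ _) (W2_le_lpNorm_sub hZ (hσ.comp hX)) 2
      _ ≤ _ := h.sq_lpNorm_sub_displacement_le hX hY (P2.memLp_of_hasLaw hZ) hs0 hs1
      _ ≤ bound δ := by
        have := h.pos
        have := sub_pos.2 hs1
        simp only [bound]
        gcongr <;> exact lpNorm_nonneg
  have hzero : bound 0 = 0 := by simp only [bound]; ring
  have hcont : ContinuousWithinAt bound (Set.Ioi 0) 0 := by fun_prop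
  have := ge_of_tendsto hcont (Filter.eventually_of_mem self_mem_nhdsWithin hbound)
  rw [hzero] at this
  exact eq_of_W2_eq_zero (pow_eq_zero_iff two_ne_zero |>.1 (this.antisymm (sq_nonneg _)))

theorem isGeodesic_iff (h : IsStableTransport T a μ ν) {γ₀ : unitInterval → P2 d}
    (hγ₀ : ∀ t : unitInterval, HasLaw ((1 - (t : ℝ)) • id + (t : ℝ) • T) (γ₀ t).1 μ.1)
    {γ : unitInterval → P2 d} : IsGeodesic W2 μ ν γ ↔ ∀ t, γ t = γ₀ t := by
  refine ⟨fun hγ t ↦ h.eq_of_W2_le t.2.1 t.2.2 ?_ ?_ (hγ₀ t), fun hγ ↦ ?_⟩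
  · simpa [hγ.1, abs_of_nonneg t.2.1] using (hγ.2.2 0 t).le
  · simpa [hγ.2.1, abs_sub_comm (t : ℝ) 1, abs_of_nonneg (sub_nonneg.2 t.2.2)] using
      (hγ.2.2 t 1).le
  · obtain rfl : γ = γ₀ := funext hγ
    refine isGeodesic_of_dist_le W2_comm W2_triangle
      (Subtype.ext ((hγ₀ 0).map_eq.symm.trans (by simp)))
      (Subtype.ext ((hγ₀ 1).map_eq.symm.trans ?_)) fun s t ↦ h.W2_displacement_le (hγ₀ s) (hγ₀ t)
    simpa using h.hasLaw.map_eq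

end IsStableTransport

end StableTransport

section AffineTransport

open scoped RealInnerProductSpace

theorem integrable_inner_of_memLp_two {E Ω : Type*} [NormedAddCommGroup E]
    [InnerProductSpace ℝ E] {mΩ : MeasurableSpace Ω} {P : Measure Ω} {X Y : Ω → E}
    (hX : MemLp X 2 P) (hY : MemLp Y 2 P) : Integrable (fun ω ↦ ⟪X ω, Y ω⟫) P := by
  refine (hX.norm.integrable_mul hY.norm).mono' (hX.1.inner hY.1) (.of_forall fun ω ↦ ?_)
  exact norm_inner_le_norm _ _

theorem sq_norm_sub_eq_potentials_add {E : Type*} [NormedAddCommGroup E] [InnerProductSpace ℝ E]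
    {A B : E →L[ℝ] E} (hB : B.IsSymmetric) (hBA : ∀ x, B (A x) = x) (b x y : E) :
    ‖x - y‖ ^ 2 = (‖x‖ ^ 2 - ⟪x, A x⟫ - 2 * ⟪x, b⟫) + (‖y‖ ^ 2 - ⟪y - b, B (y - b)⟫) +
      ⟪y - (b + A x), B (y - (b + A x))⟫ := by
  have hsymm : ⟪A x, B (y - b)⟫ = ⟪x, y - b⟫ := by
    rw [← hB.apply_clm, hBA]
  have hquad : ⟪y - b - A x, B (y - b) - x⟫ =
      ⟪y - b, B (y - b)⟫ - 2 * ⟪x, y - b⟫ + ⟪x, A x⟫ := by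
    rw [inner_sub_left, inner_sub_right, inner_sub_right, hsymm, real_inner_comm x (y - b),
      real_inner_comm x (A x)]
    ring
  rw [← sub_sub, map_sub B (y - b), hBA, hquad, inner_sub_right x y b, norm_sub_sq_real]
  ring

namespace IsStableTransport

variable {d : ℕ} {a : ℝ} {μ ν : P2 d}

-- Kantorovich duality, with the slack `a * ‖y - T x‖ ^ 2` kept on the side of the plan.
theorem of_potentials {T : EuclideanSpace ℝ (Fin d) → EuclideanSpace ℝ (Fin d)} (ha : 0 < a)
    (hT : HasLaw T ν.1 μ.1) {φ ψ : EuclideanSpace ℝ (Fin d) → ℝ} (hφ : Integrable φ μ.1)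
    (hψ : Integrable ψ ν.1) (hle : ∀ x y, φ x + ψ y + a * ‖y - T x‖ ^ 2 ≤ ‖x - y‖ ^ 2)
    (heq : ∀ x, φ x + ψ (T x) = ‖x - T x‖ ^ 2) : IsStableTransport T a μ ν := by
  refine ⟨ha, hT, fun π hπ ↦ ?_⟩
  have hfst := couplings.hasLaw_fst hπ
  have hsnd := couplings.hasLaw_snd hπ
  have hcost := P2.memLp_of_hasLaw hfst |>.sub (P2.memLp_of_hasLaw hsnd)
  have hgraph := P2.memLp_of_hasLaw hsnd |>.sub (P2.memLp_of_hasLaw (hT.comp hfst))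
  have hφ' : Integrable (fun z ↦ φ z.1) π := integrable_comp_hasLaw hφ hfst
  have hψ' : Integrable (fun z ↦ ψ z.2) π := integrable_comp_hasLaw hψ hsnd
  have hψT : Integrable (fun x ↦ ψ (T x)) μ.1 := integrable_comp_hasLaw hψ hT
  have hpot : Integrable (fun z ↦ φ z.1 + ψ z.2) π := hφ'.add hψ'
  have hslack : Integrable (fun z ↦ a * ‖z.2 - T z.1‖ ^ 2) π :=
    hgraph.norm.integrable_sq.const_mul a
  calc lpNorm (id - T) 2 μ.1 ^ 2 + a * lpNorm (Prod.snd - T ∘ Prod.fst) 2 π ^ 2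
    _ = ∫ x, φ x + ψ (T x) ∂μ.1 + ∫ z, a * ‖z.2 - T z.1‖ ^ 2 ∂π := by
      rw [sq_lpNorm_two (aestronglyMeasurable_id.sub hT.aemeasurable.aestronglyMeasurable),
        sq_lpNorm_two hgraph.1, integral_const_mul]
      simp only [heq, Pi.sub_apply, id, Function.comp_apply]
    _ = ∫ z, φ z.1 + ψ z.2 + a * ‖z.2 - T z.1‖ ^ 2 ∂π := by
      rw [integral_add hφ hψT, integral_add hpot hslack, integral_add hφ' hψ']
      congr 2
      · exact (hfst.integral_comp hφ.1).symm
      · exact (hT.integral_comp hψ.1).trans (hsnd.integral_comp hψ.1).symm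
    _ ≤ ∫ z, ‖z.1 - z.2‖ ^ 2 ∂π :=
      integral_mono (hpot.add hslack) hcost.norm.integrable_sq fun z ↦ hle z.1 z.2
    _ = lpNorm (Prod.fst - Prod.snd) 2 π ^ 2 := (sq_lpNorm_two hcost.1).symm

theorem affine {A B : EuclideanSpace ℝ (Fin d) →L[ℝ] EuclideanSpace ℝ (Fin d)}
    (hB : B.IsSymmetric) (hBA : ∀ x, B (A x) = x) (ha : 0 < a)
    (hcoercive : ∀ u, a * ‖u‖ ^ 2 ≤ ⟪u, B u⟫) {b : EuclideanSpace ℝ (Fin d)}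
    (hlaw : HasLaw (fun x ↦ b + A x) ν.1 μ.1) :
    IsStableTransport (fun x ↦ b + A x) a μ ν := by
  have hμ : MemLp id 2 μ.1 := P2.memLp_of_hasLaw .id
  have hν : MemLp id 2 ν.1 := P2.memLp_of_hasLaw .id
  have hsub : MemLp (fun y ↦ y - b) 2 ν.1 := hν.sub (memLp_const b)
  have hφ : Integrable (fun x ↦ ‖x‖ ^ 2 - ⟪x, A x⟫ - 2 * ⟪x, b⟫) μ.1 :=
    (hμ.norm.integrable_sq.sub (integrable_inner_of_memLp_two hμ (A.comp_memLp' hμ))).sub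
      ((integrable_inner_of_memLp_two hμ (memLp_const b)).const_mul 2)
  have hψ : Integrable (fun y ↦ ‖y‖ ^ 2 - ⟪y - b, B (y - b)⟫) ν.1 :=
    hν.norm.integrable_sq.sub (integrable_inner_of_memLp_two hsub (B.comp_memLp' hsub))
  refine of_potentials ha hlaw hφ hψ (fun x y ↦ ?_) fun x ↦ ?_
  · rw [sq_norm_sub_eq_potentials_add hB hBA b x y]
    gcongr
    exact hcoercive _
  · rw [sq_norm_sub_eq_potentials_add hB hBA b x, sub_self, map_zero, inner_zero_left, add_zero]

end IsStableTransport

end AffineTransport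

section PosDef

open scoped RealInnerProductSpace MatrixOrder

open CFC in
theorem exists_isStrictlyPositive_mul_mul_eq {A : Type*} [PartialOrder A] [Ring A] [StarRing A]
    [TopologicalSpace A] [StarOrderedRing A] [Algebra ℝ A]
    [ContinuousFunctionalCalculus ℝ A IsSelfAdjoint] [NonnegSpectrumClass ℝ A]
    [IsSemitopologicalRing A] [T2Space A] {a b : A} (ha : IsStrictlyPositive a)
    (hb : IsStrictlyPositive b) : ∃ c : A, IsStrictlyPositive c ∧ c * a * c = b := by
  have hab : IsStrictlyPositive (conjSqrt a b) := (isStrictlyPositive_conjSqrt_iff a b).2 hb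
  set q := sqrt (conjSqrt a b)
  set r := sqrt (Ring.inverse a)
  refine ⟨conjSqrt (Ring.inverse a) q,
    (isStrictlyPositive_conjSqrt_iff _ _ ha.ringInverse).2 hab.sqrt, ?_⟩
  have hrar : r * a * r = 1 := by
    simpa only [conjSqrt_one a, conjSqrt_apply] using conjSqrt_ringInverse_conjSqrt a 1
  calc r * q * r * a * (r * q * r) = r * (q * (r * a * r) * q) * r := by noncomm_ring
    _ = conjSqrt (Ring.inverse a) (conjSqrt a b) := by
      rw [hrar, mul_one, sqrt_mul_sqrt_self _ hab.nonneg]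
      rfl
    _ = b := conjSqrt_ringInverse_conjSqrt a b

variable {n : Type*} [DecidableEq n]

theorem posDef_one_sub_smul_one_add_smul {M : Matrix n n ℝ} (hM : M.PosDef) {t : ℝ}
    (ht : t ∈ unitInterval) : ((1 - t) • 1 + t • M).PosDef := by
  rcases ht.1.eq_or_lt with rfl | h
  · simpa using Matrix.PosDef.one
  · exact .posSemidef_add (Matrix.PosSemidef.one.smul (sub_nonneg.2 ht.2)) (hM.smul h)

variable [Fintype n]

theorem isSymmetric_toEuclideanCLM {M : Matrix n n ℝ} (hM : M.IsHermitian) :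
    (Matrix.toEuclideanCLM (𝕜 := ℝ) M).IsSymmetric :=
  Matrix.isSymmetric_toEuclideanLin_iff.2 hM

theorem exists_mul_sq_norm_le_inner_toEuclideanCLM {M : Matrix n n ℝ} (hM : M.PosDef) :
    ∃ c > 0, ∀ w, c * ‖w‖ ^ 2 ≤ ⟪w, Matrix.toEuclideanCLM (𝕜 := ℝ) M w⟫ := by
  cases isEmpty_or_nonempty n
  · exact ⟨1, one_pos, fun w ↦ by simp [Subsingleton.elim w 0]⟩
  have hM' := hM.isStrictlyPositive
  obtain ⟨c, hc, hle⟩ := (CFC.exists_pos_algebraMap_le_iff hM'.isSelfAdjoint).2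
    fun x hx ↦ hM'.spectrum_pos hx
  refine ⟨c, hc, fun w ↦ ?_⟩
  have hnonneg := (Matrix.le_iff.1 hle).dotProduct_mulVec_nonneg w
  rw [star_trivial, ← Matrix.inner_toEuclideanCLM, Algebra.algebraMap_eq_smul_one, map_sub,
    map_smul, map_one, sub_apply, inner_sub_right] at hnonneg
  simpa [inner_smul_right] using hnonneg

theorem map_affine_multivariateGaussian {S : Matrix n n ℝ} (hS : S.PosSemidef)
    (m b : EuclideanSpace ℝ n) (M : Matrix n n ℝ) :
    (multivariateGaussian m S).map (fun x ↦ b + Matrix.toEuclideanCLM (𝕜 := ℝ) M x) =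
      multivariateGaussian (b + Matrix.toEuclideanCLM (𝕜 := ℝ) M m) (M * S * M.conjTranspose) := by
  set L := Matrix.toEuclideanCLM (𝕜 := ℝ) M
  have hcomp : (multivariateGaussian m S).map (fun x ↦ b + L x) =
      ((multivariateGaussian m S).map L).map (b + ·) :=
    (Measure.map_map (by fun_prop) (by fun_prop)).symm
  rw [hcomp]
  refine IsGaussian.ext ?_ ?_
  · have hint := IsGaussian.integrable_fun_id (μ := (multivariateGaussian m S).map L)
    simp only [id]
    rw [integral_id_multivariateGaussian, integral_map (by fun_prop) (by fun_prop),
      integral_add (integrable_const b) hint, integral_const,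
      L.integral_id_map IsGaussian.integrable_id, probReal_univ, one_smul,
      integral_id_multivariateGaussian]
  · ext x y
    rw [covarianceBilin_map_const_add, covarianceBilin_map IsGaussian.memLp_two_id,
      covarianceBilin_multivariateGaussian hS,
      covarianceBilin_multivariateGaussian (hS.mul_mul_conjTranspose_same M),
      ← Matrix.inner_toEuclideanCLM, ← Matrix.inner_toEuclideanCLM,
      ContinuousLinearMap.adjoint_inner_left, map_mul, map_mul, ← Matrix.star_eq_conjTranspose,
      map_star]
    rfl

end PosDef

section Gaussian

variable {d : ℕ}

theorem hasLaw_affine_gaussianP2 {S M : Matrix (Fin d) (Fin d) ℝ} (hS : S.PosSemidef)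
    (hM : M.IsHermitian) {m n b : EuclideanSpace ℝ (Fin d)}
    (hb : b + Matrix.toEuclideanCLM (𝕜 := ℝ) M m = n) :
    HasLaw (fun x ↦ b + Matrix.toEuclideanCLM (𝕜 := ℝ) M x) (gaussianP2 n (M * S * M)).1
      (gaussianP2 m S).1 :=
  ⟨by fun_prop, by simpa only [gaussianP2, hM.eq, hb] using
    map_affine_multivariateGaussian hS m b M⟩

theorem one_sub_smul_id_add_smul_affine (M : Matrix (Fin d) (Fin d) ℝ)
    (b : EuclideanSpace ℝ (Fin d)) (t : ℝ) :
    (1 - t) • id + t • (fun x ↦ b + Matrix.toEuclideanCLM (𝕜 := ℝ) M x) =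
      fun x ↦ t • b + Matrix.toEuclideanCLM (𝕜 := ℝ) ((1 - t) • 1 + t • M) x := by
  ext1 x
  simp only [Pi.add_apply, Pi.smul_apply, id, map_add, map_smul, map_one, add_apply,
    smul_apply, one_apply_eq_self, smul_add]
  abel

theorem isGeodesic_gaussianP2_iff {S M : Matrix (Fin d) (Fin d) ℝ} (hS : S.PosSemidef)
    (hM : M.PosDef) (m n : EuclideanSpace ℝ (Fin d)) {γ : unitInterval → P2 d} :
    IsGeodesic W2 (gaussianP2 m S) (gaussianP2 n (M * S * M)) γ ↔
      ∀ t : unitInterval, γ t = gaussianP2 ((1 - (t : ℝ)) • m + (t : ℝ) • n)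
        (((1 - (t : ℝ)) • 1 + (t : ℝ) • M) * S * ((1 - (t : ℝ)) • 1 + (t : ℝ) • M)) := by
  set A := Matrix.toEuclideanCLM (𝕜 := ℝ) M
  have hinv (x : EuclideanSpace ℝ (Fin d)) : Matrix.toEuclideanCLM (𝕜 := ℝ) M⁻¹ (A x) = x := by
    rw [← mul_apply_eq_comp, ← map_mul,
      Matrix.nonsing_inv_mul _ ((Matrix.isUnit_iff_isUnit_det _).1 hM.isUnit), map_one,
      one_apply_eq_self]
  obtain ⟨c, hc, hcoercive⟩ := exists_mul_sq_norm_le_inner_toEuclideanCLM hM.inv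
  have hstable : IsStableTransport (fun x ↦ (n - A m) + A x) c (gaussianP2 m S)
      (gaussianP2 n (M * S * M)) :=
    .affine (isSymmetric_toEuclideanCLM hM.inv.isHermitian) hinv hc hcoercive
      (hasLaw_affine_gaussianP2 hS hM.isHermitian (sub_add_cancel _ _))
  refine hstable.isGeodesic_iff fun t ↦ ?_
  rw [one_sub_smul_id_add_smul_affine]
  refine hasLaw_affine_gaussianP2 hS (posDef_one_sub_smul_one_add_smul hM t.2).isHermitian ?_
  rw [← congrFun (one_sub_smul_id_add_smul_affine M (n - A m) t) m]
  simp only [Pi.add_apply, Pi.smul_apply, id, A, sub_add_cancel]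

open scoped MatrixOrder in
theorem geodesicallyConvex_nondegenerateGaussians (d : ℕ) :
    GeodesicallyConvex (W2 (d := d)) (nondegenerateGaussians d) := by
  refine .of_unique ?_
  rintro _ ⟨m, S, hS, rfl⟩ _ ⟨n, S', hS', rfl⟩
  obtain ⟨M, hM, rfl⟩ := exists_isStrictlyPositive_mul_mul_eq hS.isStrictlyPositive
    hS'.isStrictlyPositive
  rw [Matrix.isStrictlyPositive_iff_posDef] at hM
  refine ⟨_, fun t ↦ ⟨_, _, ?_, rfl⟩,
    fun γ ↦ isGeodesic_gaussianP2_iff hS.posSemidef hM m n⟩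
  have hMt := posDef_one_sub_smul_one_add_smul hM t.2
  simpa only [Matrix.star_eq_conjTranspose, hMt.isHermitian.eq] using
    (Matrix.IsUnit.posDef_star_left_conjugate_iff hMt.isUnit).2 hS

theorem isGeodesic_isotropicGaussian_iff (m n : EuclideanSpace ℝ (Fin d)) {ε δ : ℝ} (hε : 0 < ε)
    (hδ : 0 < δ) {γ : unitInterval → P2 d} :
    IsGeodesic W2 (isotropicGaussian m ε) (isotropicGaussian n δ) γ ↔
      ∀ t : unitInterval, γ t = isotropicGaussian ((1 - (t : ℝ)) • m + (t : ℝ) • n)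
        (((1 - (t : ℝ)) + (t : ℝ) * √(δ / ε)) ^ 2 * ε) := by
  have hconj (r : ℝ) : (r • 1 : Matrix (Fin d) (Fin d) ℝ) * (ε • 1) * (r • 1) =
      (r ^ 2 * ε) • 1 := by
    simp only [smul_mul_assoc, mul_smul_comm, one_mul, smul_smul]
    ring_nf
  have hδε : 0 < δ / ε := div_pos hδ hε
  have hiff := isGeodesic_gaussianP2_iff (γ := γ) (Matrix.PosSemidef.one.smul hε.le)
    (Matrix.PosDef.one.smul (Real.sqrt_pos.2 hδε)) m n
  simpa only [isotropicGaussian, smul_smul, ← add_smul, hconj, Real.sq_sqrt hδε.le,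
    div_mul_cancel₀ _ hε.ne'] using hiff

theorem geodesicallyConvex_isotropicGaussians (d : ℕ) :
    GeodesicallyConvex (W2 (d := d)) (isotropicGaussians d) := by
  refine .of_unique ?_
  rintro _ ⟨m, ε, hε, rfl⟩ _ ⟨n, δ, hδ, rfl⟩
  refine ⟨_, fun t ↦ ⟨_, _, ?_, rfl⟩, fun γ ↦ isGeodesic_isotropicGaussian_iff m n hε hδ⟩
  have hscale : (1 - (t : ℝ)) • 1 + (t : ℝ) • √(δ / ε) ∈ Set.Ioi 0 :=
    convex_Ioi (0 : ℝ) (Set.mem_Ioi.2 one_pos) (Real.sqrt_pos.2 (div_pos hδ hε))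
      (sub_nonneg.2 t.2.2) t.2.1 (sub_add_cancel _ _)
  rw [Set.mem_Ioi, smul_eq_mul, smul_eq_mul, mul_one] at hscale
  positivity

theorem isotropicGaussians_subset_nondegenerateGaussians (d : ℕ) :
    isotropicGaussians d ⊆ nondegenerateGaussians d := by
  rintro _ ⟨m, ε, hε, rfl⟩
  exact ⟨m, _, Matrix.PosDef.one.smul hε, rfl⟩

end Gaussian

theorem mainTheorem4 (d : ℕ) :
    -- isotropic Gaussians form a geodesically convex subset of the Bures–Wasserstein space
    (isotropicGaussians d ⊆ nondegenerateGaussians d ∧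
      GeodesicallyConvex (BW (d := d)) {μ : BuresWasserstein d | μ.1 ∈ isotropicGaussians d}) ∧
    -- the Bures–Wasserstein space is geodesically convex in the Wasserstein space
    GeodesicallyConvex (W2 (d := d)) (nondegenerateGaussians d) ∧
    -- the W₂ geodesic between two isotropic Gaussians
    (∀ (m_p m_q : EuclideanSpace ℝ (Fin d)) (ε_p ε_q : ℝ), 0 < ε_p → 0 < ε_q →
      ∀ γ : unitInterval → P2 d,
        IsGeodesic W2 (isotropicGaussian m_p ε_p) (isotropicGaussian m_q ε_q) γ ↔
          ∀ t : unitInterval, γ t = isotropicGaussian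
            ((1 - (t : ℝ)) • m_p + (t : ℝ) • m_q)
            (((1 - (t : ℝ)) + (t : ℝ) * Real.sqrt (ε_q / ε_p)) ^ 2 * ε_p)) := by
  have hsubset := isotropicGaussians_subset_nondegenerateGaussians d
  exact ⟨⟨hsubset, (geodesicallyConvex_isotropicGaussians d).subtype hsubset⟩,
    geodesicallyConvex_nondegenerateGaussians d,
    fun m_p m_q _ _ hp hq _ ↦ isGeodesic_isotropicGaussian_iff m_p m_q hp hq⟩
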